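/- Let $\mathfrak{H}=\mathbb{Q}\langle x,y\rangle$ be the non-commutative polynomial ring, let $\mathfrak{H}^1=\mathbb{Q}+y\mathfrak{H}$, and put $z_k=yx^{k-1}$ for $k\ge 1$. For a tuple $\boldsymbol{k}=(k_1,\dots,k_r)$ of positive integers put $z_{\boldsymbol{k}}=z_{k_1}\cdots z_{k_r}$ (with $z_\varnothing=1$); these elements form a $\mathbb{Q}$-basis of $\mathfrak{H}^1$. Let ш be the shuffle product on $\mathfrak{H}$, i.e. the $\mathbb{Q}$-bilinear product with $a\,ш\,1=1\,ш\,a=a$ and $(a_1u_1)\,ш\,(a_2u_2)=(a_1\,ш\,a_2u_2)u_1+(a_1u_1\,ш\,a_2)u_2$ for $a,a_1,a_2\in\mathfrak{H}$ and $u_1,u_2\in\{x,y\}$. For a tuple $\boldsymbol{k}=(k_1,\dots,k_r)$ of non-negative integers, write $\mathrm{wt}(\boldsymbol{k})=k_1+\cdots+k_r$, $\boldsymbol{k}_{[i]}=(k_1,\dots,k_i)$, $\boldsymbol{k}^{[i]}=(k_{i+1},\dots,k_r)$ and $\overline{\boldsymbol{k}}=(k_r,\dots,k_1)$. The $t$-adic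 symmetrization map $\widehat{\phi}\colon\mathfrak{H}^1[[t]]\to\mathfrak{H}^1[[t]]$ is the $\mathbb{Q}[[t]]$-linear, $t$-adically continuous map such that, for every $r\ge0$ and every tuple $\boldsymbol{k}=(k_1,\dots,k_r)$ of positive integers, $$\widehat{\phi}(z_{\boldsymbol{k}})=\sum_{i=0}^{r}(-1)^{\mathrm{wt}(\boldsymbol{k}^{[i]})}\,z_{\boldsymbol{k}_{[i]}}\,ш\sum_{\boldsymbol{l}=(l_{i+1},\dots,l_r)\in\mathbb{Z}_{\ge0}^{r-i}}\Bigl(\prod_{j=i+1}^{r}\binom{k_j+l_j-1}{l_j}\Bigr)z_{\overline{\boldsymbol{k}^{[i]}+\boldsymbol{l}}}\;t^{\mathrm{wt}(\boldsymbol{l})},$$ where ш is applied to each coefficient of the power series in $t$. Then for every $r\ge1$ and all positive integers $k_1,\dots,k_{r+1}$ the following equality holds in $\mathfrak{H}^1[[t]]$: $$\widehat{\phi}\bigl((z_{k_1}ш\cdots ш z_{k_r})x^{k_{r+1}}\bigr)=(z_{k_1}ш\cdots ш z_{k_r})x^{k_{r+1}}+\sum_{i=1}^{r}(-1)^{k_i+k_{r+1}}\sum_{l,l'\ge0}\binom{k_i+l-1}{l}\binom{k_{r+1}+l'-1}{l'}\,(z_{k_1}ш\cdots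 ш\check{z}_{k_i}ш\cdots ш z_{k_r}ш z_{k_{r+1}+l'})\,x^{k_i+l}\,t^{l+l'},$$ where $\check{z}_{k_i}$ means that the factor $z_{k_i}$ is omitted. -/

import Mathlib

open scoped PowerSeries

namespace TAdicSym

/-- The two letters. -/
inductive Letter : Type
  | x : Letter
  | y : Letter

/-- `𝔥 = ℚ⟨x, y⟩`, the non-commutative polynomial ring. -/
abbrev H : Type := FreeAlgebra ℚ Letter

noncomputable section

/-- The variable `x`. -/
def x : H := FreeAlgebra.ι ℚ Letter.x

/-- The variable `y`. -/
def y : H := FreeAlgebra.ι ℚ Letter.y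

/-- The word `u₁ u₂ ⋯ uₙ` as an element of `𝔥`. -/
def word (w : List Letter) : H := (w.map (FreeAlgebra.ι ℚ)).prod

/-- The words form a `ℚ`-basis of `𝔥`. -/
def wordBasis : Module.Basis (List Letter) ℚ H :=
  (FreeAlgebra.basisFreeMonoid ℚ Letter).reindex (FreeMonoid.toList (α := Letter))

theorem wordBasis_apply (w : List Letter) : wordBasis w = word w := by
  simp only [wordBasis, Module.Basis.reindex_apply, FreeAlgebra.basisFreeMonoid, word]
  simp [FreeAlgebra.equivMonoidAlgebraFreeMonoid, FreeMonoid.lift_apply]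

theorem word_append (u v : List Letter) : word (u ++ v) = word u * word v := by
  simp [word]

theorem word_cons (a : Letter) (v : List Letter) :
    word (a :: v) = FreeAlgebra.ι ℚ a * word v := by
  simp [word]

/-! ### The shuffle product -/

/-- The shuffle of two words which are given in reversed order (so that the head of a list
is the last letter of the word): `1 ш v = v`, `u ш 1 = u`,
`(a₁u₁) ш (a₂u₂) = (a₁ ш a₂u₂)u₁ + (a₁u₁ ш a₂)u₂`. -/
def shRev : List Letter → List Letter → H
  | [], v => word v.reverse
  | u, [] => word u.reverse
  | u₁ :: a₁, u₂ :: a₂ =>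
      shRev a₁ (u₂ :: a₂) * FreeAlgebra.ι ℚ u₁ + shRev (u₁ :: a₁) a₂ * FreeAlgebra.ι ℚ u₂
termination_by u v => u.length + v.length

/-- The shuffle product on `𝔥`, the bilinear extension of the shuffle of words. -/
def sh : H →ₗ[ℚ] H →ₗ[ℚ] H :=
  wordBasis.constr ℚ fun u => wordBasis.constr ℚ fun v => shRev u.reverse v.reverse

theorem sh_word (u v : List Letter) : sh (word u) (word v) = shRev u.reverse v.reverse := by
  rw [← wordBasis_apply u, ← wordBasis_apply v, sh, Module.Basis.constr_basis,
    Module.Basis.constr_basis]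

theorem one_sh (a : H) : sh 1 a = a := by
  have h : sh 1 = LinearMap.id := by
    refine wordBasis.ext fun v => ?_
    have := sh_word [] v
    rw [wordBasis_apply]
    simpa [word, shRev] using this
  rw [h]; rfl

theorem sh_one (a : H) : sh a 1 = a := by
  have h : sh.flip 1 = LinearMap.id := by
    refine wordBasis.ext fun v => ?_
    have := sh_word v []
    have h2 : shRev v.reverse [] = word v := by
      cases h : v.reverse with
      | nil => simp at h; simp [shRev, h]
      | cons a l => rw [shRev, ← h, List.reverse_reverse]; simp
    rw [wordBasis_apply]
    simpa [word, h2] using this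
  exact LinearMap.congr_fun h a

@[elab_as_elim]
theorem induction_word {p : H → Prop} (a : H) (hw : ∀ w, p (word w)) (h0 : p 0)
    (hadd : ∀ a b, p a → p b → p (a + b)) (hsmul : ∀ (c : ℚ) a, p a → p (c • a)) : p a := by
  have h : a ∈ Submodule.span ℚ (Set.range wordBasis) := wordBasis.mem_span a
  induction h using Submodule.span_induction with
  | mem b hb => obtain ⟨w, rfl⟩ := hb; rw [wordBasis_apply]; exact hw w
  | zero => exact h0
  | add a b _ _ ha hb => exact hadd a b ha hb
  | smul c a _ ha => exact hsmul c a ha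

/-- The recursive rule of the shuffle product, which together with `one_sh` and `sh_one`
determines it. -/
theorem mul_letter_sh_mul_letter (a₁ a₂ : H) (u₁ u₂ : Letter) :
    sh (a₁ * FreeAlgebra.ι ℚ u₁) (a₂ * FreeAlgebra.ι ℚ u₂)
      = sh a₁ (a₂ * FreeAlgebra.ι ℚ u₂) * FreeAlgebra.ι ℚ u₁
        + sh (a₁ * FreeAlgebra.ι ℚ u₁) a₂ * FreeAlgebra.ι ℚ u₂ := by
  have hw : ∀ (w : List Letter) (u : Letter),
      word w * FreeAlgebra.ι ℚ u = word (w ++ [u]) := fun w u => by simp [word]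
  refine induction_word a₁ (fun v => ?_) ?_ (fun p q hp hq => ?_) (fun c p hp => ?_)
  · refine induction_word a₂ (fun w => ?_) ?_ (fun p q hp hq => ?_) (fun c p hp => ?_)
    · rw [hw, hw, sh_word, sh_word, sh_word]
      simp [shRev]
    · simp
    · simp only [add_mul, map_add, hp, hq]; abel
    · simp only [smul_mul_assoc, map_smul, hp, smul_add]
  · simp
  · simp only [add_mul, map_add, LinearMap.add_apply, hp, hq]; abel
  · simp only [smul_mul_assoc, map_smul, LinearMap.smul_apply, hp, smul_add]

/-- `a₁ ш a₂ ш ⋯ ш aₙ` (which is `1` for the empty list). -/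
def shProd (L : List H) : H := L.foldl (fun a b => sh a b) 1

/-! ### The subalgebra `𝔥¹` -/

/-- The subspace `y𝔥` of `𝔥`. -/
def yH : Submodule ℚ H := LinearMap.range (LinearMap.mulLeft ℚ y)

theorem y_mul_mem (a : H) : y * a ∈ yH := ⟨a, rfl⟩

theorem yH_mul_mem {a : H} (ha : a ∈ yH) (b : H) : a * b ∈ yH := by
  obtain ⟨c, rfl⟩ := ha
  exact ⟨c * b, by simp [mul_assoc]⟩

/-- `𝔥¹ = ℚ + y𝔥`. -/
def H1 : Subalgebra ℚ H where
  carrier := {a | ∃ (c : ℚ) (b : H), a = algebraMap ℚ H c + y * b}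
  mul_mem' := by
    rintro _ _ ⟨c, b, rfl⟩ ⟨c', b', rfl⟩
    refine ⟨c * c', b * algebraMap ℚ H c' + algebraMap ℚ H c * b' + b * (y * b'), ?_⟩
    rw [map_mul, add_mul, mul_add, mul_add, mul_add, mul_add]
    rw [← mul_assoc (algebraMap ℚ H c) y b', Algebra.commutes c y]
    simp only [mul_assoc]
    abel
  add_mem' := by
    rintro _ _ ⟨c, b, rfl⟩ ⟨c', b', rfl⟩
    exact ⟨c + c', b + b', by rw [map_add, mul_add]; abel⟩
  algebraMap_mem' := fun c => ⟨c, 0, by simp⟩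

theorem mem_H1_of_mem_yH {a : H} (ha : a ∈ yH) : a ∈ H1 := by
  obtain ⟨b, rfl⟩ := ha
  exact ⟨0, b, by simp⟩

/-- `z_k = y x^{k-1}` (for `k ≥ 1`). -/
def z (k : ℕ) : H := y * x ^ (k - 1)

/-- `z_{k₁} z_{k₂} ⋯ z_{kᵣ}`. -/
def zWord (k : List ℕ) : H := (k.map z).prod

theorem z_mem_yH (k : ℕ) : z k ∈ yH := y_mul_mem _

theorem zWord_mem_H1 (k : List ℕ) : zWord k ∈ H1 := by
  refine Subalgebra.list_prod_mem _ fun a ha => ?_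
  obtain ⟨k, -, rfl⟩ := List.mem_map.1 ha
  exact mem_H1_of_mem_yH (z_mem_yH k)

theorem shRev_mem (u v : List Letter) (hu : u = [] ∨ ∃ u', u = u' ++ [Letter.y])
    (hv : v = [] ∨ ∃ v', v = v' ++ [Letter.y]) (h : u ≠ [] ∨ v ≠ []) : shRev u v ∈ yH := by
  have hrev : ∀ w : List Letter, (∃ w', w = w' ++ [Letter.y]) → word w.reverse ∈ yH := by
    rintro _ ⟨w, rfl⟩
    rw [List.reverse_append, List.reverse_singleton, List.singleton_append, word_cons]
    exact y_mul_mem _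
  have htail : ∀ (a : Letter) (w : List Letter), (∃ w', a :: w = w' ++ [Letter.y]) →
      w = [] ∨ ∃ w', w = w' ++ [Letter.y] := by
    rintro a w ⟨w', hw'⟩
    cases w' with
    | nil => left; simpa using (List.cons.inj hw').2
    | cons b w'' => right; exact ⟨w'', (List.cons.inj hw').2⟩
  induction u, v using shRev.induct with
  | case1 v =>
    rw [shRev]
    rcases hv with rfl | hv
    · simp at h
    · exact hrev v hv
  | case2 u hne =>
    have hu' : u ≠ [] := by simpa using h
    rcases hu with rfl | hu
    · exact absurd rfl hu'
    · cases u with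
      | nil => exact absurd rfl hu'
      | cons a u => rw [shRev]; exact hrev _ hu; simp
  | case3 u₁ a₁ u₂ a₂ ih₁ ih₂ =>
    have hu' : ∃ u', u₁ :: a₁ = u' ++ [Letter.y] := by simpa using hu
    have hv' : ∃ v', u₂ :: a₂ = v' ++ [Letter.y] := by simpa using hv
    rw [shRev]
    exact add_mem (yH_mul_mem (ih₁ (htail _ _ hu') hv (by simp)) _)
      (yH_mul_mem (ih₂ hu (htail _ _ hv') (by simp)) _)

theorem yH_sh_yH {a b : H} (ha : a ∈ yH) (hb : b ∈ yH) : sh a b ∈ yH := by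
  obtain ⟨a, rfl⟩ := ha
  obtain ⟨b, rfl⟩ := hb
  simp only [LinearMap.mulLeft_apply]
  refine induction_word a (fun v => ?_) ?_ (fun p q hp hq => ?_) (fun c p hp => ?_)
  · refine induction_word b (fun w => ?_) ?_ (fun p q hp hq => ?_) (fun c p hp => ?_)
    · rw [y, ← word_cons, ← word_cons, sh_word]
      exact shRev_mem _ _ (by simp) (by simp) (by simp)
    · simp
    · rw [mul_add, map_add]; exact add_mem hp hq
    · rw [mul_smul_comm, map_smul]; exact yH.smul_mem _ hp
  · simp
  · rw [mul_add, map_add, LinearMap.add_apply]; exact add_mem hp hq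
  · rw [mul_smul_comm, map_smul, LinearMap.smul_apply]; exact yH.smul_mem _ hp

/-- `𝔥¹` is closed under the shuffle product. -/
theorem sh_mem_H1 {a b : H} (ha : a ∈ H1) (hb : b ∈ H1) : sh a b ∈ H1 := by
  obtain ⟨c, a, rfl⟩ := ha
  rw [map_add, LinearMap.add_apply, Algebra.algebraMap_eq_smul_one, map_smul,
    LinearMap.smul_apply, one_sh]
  refine add_mem (H1.smul_mem hb _) ?_
  obtain ⟨d, b, rfl⟩ := hb
  rw [map_add, Algebra.algebraMap_eq_smul_one, map_smul, sh_one]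
  exact add_mem (H1.smul_mem (mem_H1_of_mem_yH (y_mul_mem a)) _)
    (mem_H1_of_mem_yH (yH_sh_yH (y_mul_mem a) (y_mul_mem b)))

/-- `(z_{k₁} ш ⋯ ш z_{kᵣ}) x^m` lies in `𝔥¹` as soon as `r ≥ 1`. -/
theorem shProd_mul_pow_mem_H1 {r : ℕ} (hr : 1 ≤ r) (k : Fin r → ℕ) (m : ℕ) :
    shProd (List.ofFn fun i => z (k i)) * x ^ m ∈ H1 := by
  have key : ∀ (L : List H) (a : H), a ∈ yH → (∀ b ∈ L, b ∈ yH) →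
      L.foldl (fun a b => sh a b) a ∈ yH := by
    intro L
    induction L with
    | nil => intro a ha _; exact ha
    | cons b L ih =>
      intro a ha hL
      exact ih _ (yH_sh_yH ha (hL b (by simp))) fun c hc => hL c (by simp [hc])
  obtain ⟨s, rfl⟩ : ∃ s, r = s + 1 := ⟨r - 1, by omega⟩
  refine mem_H1_of_mem_yH (yH_mul_mem ?_ _)
  rw [List.ofFn_succ, shProd, List.foldl_cons, one_sh]
  refine key _ _ (z_mem_yH _) fun b hb => ?_
  obtain ⟨i, rfl⟩ := (List.mem_ofFn' _ _).1 hb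
  exact z_mem_yH _

/-! ### The basis of `𝔥¹` -/

/-- The word in the letters `x`, `y` underlying `z_{k₁} ⋯ z_{kᵣ}`. -/
def letters (k : List ℕ+) : List Letter :=
  k.flatMap fun m => Letter.y :: List.replicate ((m : ℕ) - 1) Letter.x

theorem word_letters (k : List ℕ+) : word (letters k) = zWord (k.map (↑)) := by
  induction k with
  | nil => simp [letters, word, zWord]
  | cons m k ih =>
    have h : letters (m :: k)
        = (Letter.y :: List.replicate ((m : ℕ) - 1) Letter.x) ++ letters k := rfl
    rw [h, word_append, ih]
    simp [word, zWord, z, x, y]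

/-- Reads off `(n, k)` from the word `xⁿ z_{k₁} ⋯ z_{kᵣ}`. -/
def decode : List Letter → ℕ × List ℕ+
  | [] => (0, [])
  | Letter.x :: w => ((decode w).1 + 1, (decode w).2)
  | Letter.y :: w => (0, (decode w).1.succPNat :: (decode w).2)

theorem decode_replicate (n : ℕ) (w : List Letter) :
    decode (List.replicate n Letter.x ++ w) = ((decode w).1 + n, (decode w).2) := by
  induction n with
  | zero => rfl
  | succ n ih => rw [List.replicate_succ, List.cons_append, decode, ih]; rfl

theorem decode_letters (k : List ℕ+) : decode (letters k) = (0, k) := by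
  induction k with
  | nil => rfl
  | cons m k ih =>
    have h : letters (m :: k)
        = Letter.y :: (List.replicate ((m : ℕ) - 1) Letter.x ++ letters k) := rfl
    rw [h, decode, decode_replicate, ih]
    simp only [zero_add, Prod.mk.injEq, List.cons.injEq, and_true, true_and]
    apply PNat.eq
    have := m.pos
    simp only [Nat.succPNat_coe]
    omega

theorem exists_letters (w : List Letter) :
    ∃ (n : ℕ) (k : List ℕ+), w = List.replicate n Letter.x ++ letters k := by
  induction w with
  | nil => exact ⟨0, [], rfl⟩
  | cons a w ih =>
    obtain ⟨n, k, rfl⟩ := ih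
    cases a with
    | x => exact ⟨n + 1, k, rfl⟩
    | y => exact ⟨0, n.succPNat :: k, by simp [letters]⟩

/-- `z_{k₁} ⋯ z_{kᵣ}` as an element of `𝔥¹`. -/
def zElt (k : List ℕ+) : H1 := ⟨zWord (k.map (↑)), zWord_mem_H1 _⟩

/-- The elements `z_{k₁} ⋯ z_{kᵣ}`, where `(k₁, …, kᵣ)` runs over all indices, form a
`ℚ`-basis of `𝔥¹`. -/
def zBasis : Module.Basis (List ℕ+) ℚ H1 :=
  Module.Basis.mk (v := zElt)
    (by
      have h : LinearIndependent ℚ (fun k : List ℕ+ => wordBasis (letters k)) :=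
        wordBasis.linearIndependent.comp letters fun k k' hk => by
          have := congrArg (fun w => (decode w).2) hk
          simpa [decode_letters] using this
      refine LinearIndependent.of_comp H1.val.toLinearMap ?_
      have e : (fun k : List ℕ+ => wordBasis (letters k))
          = H1.val.toLinearMap ∘ zElt := by
        funext k
        rw [wordBasis_apply, word_letters]
        rfl
      exact e ▸ h)
    (by
      have key : ∀ b : H, y * b ∈ (Submodule.span ℚ (Set.range zElt)).map
          H1.val.toLinearMap := by
        intro b
        refine induction_word b (fun w => ?_) ?_ (fun p q hp hq => ?_)
          (fun c p hp => ?_)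
        · obtain ⟨n, k, rfl⟩ := exists_letters w
          refine ⟨zElt (n.succPNat :: k), Submodule.subset_span ⟨_, rfl⟩, ?_⟩
          have : y * word (List.replicate n Letter.x ++ letters k)
              = word (letters (n.succPNat :: k)) := by
            rw [y, ← word_cons]; simp [letters]
          rw [this, word_letters]
          rfl
        · rw [mul_zero]; exact zero_mem _
        · rw [mul_add]; exact add_mem hp hq
        · rw [mul_smul_comm]; exact Submodule.smul_mem _ _ hp
      rintro ⟨_, c, b, rfl⟩ -
      obtain ⟨b', hb', hbb⟩ := key b
      have h1 : (1 : H1) ∈ Submodule.span ℚ (Set.range zElt) :=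
        Submodule.subset_span ⟨[], rfl⟩
      have h2 : c • (1 : H1) + b' ∈ Submodule.span ℚ (Set.range zElt) :=
        add_mem (Submodule.smul_mem _ _ h1) hb'
      convert h2 using 1
      apply Subtype.ext
      simp only [AlgHom.toLinearMap_apply, Subalgebra.coe_val] at hbb
      simp [Algebra.algebraMap_eq_smul_one, hbb])

theorem zBasis_apply (k : List ℕ+) : zBasis k = zElt k := by
  simp [zBasis]

/-! ### The `t`-adic symmetrization map -/

/-- `b(k, l) = ∏ᵢ binom(kᵢ + lᵢ - 1, lᵢ)`. -/
def bBinom (k l : List ℕ) : ℕ :=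
  (List.zipWith (fun a b => (a + b - 1).choose b) k l).prod

/-- The coefficient of `tⁿ` in
`∑_{i=0}^{r} (-1)^{wt(k^{[i]})} z_{k_{[i]}} ш
  ∑_{l ∈ ℕ^{r-i}} b(k^{[i]}, l) z_{rev(k^{[i]} + l)} t^{wt(l)}`,
where `k_{[i]}` consists of the first `i` entries of `k`, and `k^{[i]}` of the other ones.
The tuples `l ∈ ℕ^{r-i}` with `wt(l) = n` are enumerated by `antidiagonalTuple`. -/
def symCoeff (k : List ℕ) (n : ℕ) : H :=
  ∑ i ∈ Finset.range (k.length + 1), (-1 : ℚ) ^ (k.drop i).sum •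
    sh (zWord (k.take i))
      (∑ l ∈ Finset.Nat.antidiagonalTuple (k.length - i) n,
        (bBinom (k.drop i) (List.ofFn l) : ℚ) •
          zWord (List.zipWith (· + ·) (k.drop i) (List.ofFn l)).reverse)

theorem symCoeff_mem_H1 (k : List ℕ) (n : ℕ) : symCoeff k n ∈ H1 :=
  sum_mem fun _ _ => H1.smul_mem (sh_mem_H1 (zWord_mem_H1 _)
    (sum_mem fun _ _ => H1.smul_mem (zWord_mem_H1 _) _)) _

/-- The `ℚ`-linear map `𝔥¹ → 𝔥¹⟦t⟧` with the values `φ̂(z_k)` prescribed by `symCoeff`. -/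
def symLin : H1 →ₗ[ℚ] H1⟦X⟧ :=
  zBasis.constr ℚ fun k => PowerSeries.mk fun n => ⟨symCoeff (k.map (↑)) n, symCoeff_mem_H1 _ n⟩

/-- The `ℚ⟦t⟧`-module structure of `𝔥¹⟦t⟧`. -/
instance : Module ℚ⟦X⟧ H1⟦X⟧ :=
  Module.compHom _ (PowerSeries.map (algebraMap ℚ H1))

theorem coeff_series_smul (f : ℚ⟦X⟧) (W : H1⟦X⟧) (n : ℕ) :
    PowerSeries.coeff n (f • W)
      = ∑ p ∈ Finset.HasAntidiagonal.antidiagonal n, PowerSeries.coeff p.1 f • PowerSeries.coeff p.2 W := by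
  have : f • W = PowerSeries.map (algebraMap ℚ H1) f * W := rfl
  rw [this, PowerSeries.coeff_mul]
  refine Finset.sum_congr rfl fun p _ => ?_
  rw [PowerSeries.coeff_map, Algebra.smul_def]

/-- The `t`-adic symmetrization map `φ̂ : 𝔥¹⟦t⟧ → 𝔥¹⟦t⟧`, which is the `ℚ⟦t⟧`-linear and
`t`-adically continuous extension of `symLin`:
`φ̂(∑ₙ wₙ tⁿ) = ∑ₙ φ̂(wₙ) tⁿ`. -/
def symHat : H1⟦X⟧ →ₗ[ℚ⟦X⟧] H1⟦X⟧ where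
  toFun W := PowerSeries.mk fun n => ∑ p ∈ Finset.HasAntidiagonal.antidiagonal n,
    PowerSeries.coeff p.1 (symLin (PowerSeries.coeff p.2 W))
  map_add' V W := by
    ext n : 1
    simp [Finset.sum_add_distrib]
  map_smul' f W := by
    ext n : 1
    simp only [RingHom.id_apply, coeff_series_smul, PowerSeries.coeff_mk, map_sum,
      Finset.smul_sum, Finset.sum_sigma']
    refine Finset.sum_nbij' (fun u => ⟨(u.2.1, u.1.1 + u.2.2), (u.1.1, u.2.2)⟩)
      (fun u => ⟨(u.2.1, u.1.1 + u.2.2), (u.1.1, u.2.2)⟩) ?_ ?_ ?_ ?_ ?_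
    · rintro ⟨⟨a, b⟩, c, d⟩ h
      simp only [Finset.mem_sigma, Finset.HasAntidiagonal.mem_antidiagonal, and_true] at h ⊢
      omega
    · rintro ⟨⟨a, b⟩, c, d⟩ h
      simp only [Finset.mem_sigma, Finset.HasAntidiagonal.mem_antidiagonal, and_true] at h ⊢
      omega
    · rintro ⟨⟨a, b⟩, c, d⟩ h
      simp only [Finset.mem_sigma, Finset.HasAntidiagonal.mem_antidiagonal] at h
      simp [h.2]
    · rintro ⟨⟨a, b⟩, c, d⟩ h
      simp only [Finset.mem_sigma, Finset.HasAntidiagonal.mem_antidiagonal] at h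
      simp [h.2]
    · rintro ⟨⟨a, b⟩, c, d⟩ h
      dsimp only
      rw [map_smul]
      rfl

theorem symHat_C (w : H1) : symHat (PowerSeries.C w) = symLin w := by
  ext n : 1
  change PowerSeries.coeff n (PowerSeries.mk fun n =>
    ∑ p ∈ Finset.HasAntidiagonal.antidiagonal n,
      PowerSeries.coeff p.1 (symLin (PowerSeries.coeff p.2 (PowerSeries.C w)))) = _
  rw [PowerSeries.coeff_mk, Finset.sum_eq_single (n, 0)]
  · simp
  · rintro ⟨a, b⟩ h hb
    have : b ≠ 0 := by
      rintro rfl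
      simp only [Finset.HasAntidiagonal.mem_antidiagonal, add_zero] at h
      exact hb (by rw [h])
    simp [PowerSeries.coeff_C, this]
  · simp

/-- The defining formula of `φ̂` on the basis elements. -/
theorem coeff_symHat_zElt (k : List ℕ+) (n : ℕ) :
    ((PowerSeries.coeff n (symHat (PowerSeries.C (zElt k))) : H1) : H)
      = symCoeff (k.map (↑)) n := by
  rw [symHat_C, symLin, ← zBasis_apply, Module.Basis.constr_basis, PowerSeries.coeff_mk]

end

end TAdicSym

namespace TAdicSym

open scoped TensorProduct

/-! ### Commutativity and associativity of the shuffle product -/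

/-! Put `G = (1 - xt)⁻¹` and let `S` be the antihomomorphism with `S(u) = -uG` for both letters.
Then `S(x^(k-1) y) = (-1)^k z_k G^k`, whose coefficients carry the signs and binomials in the
definition of `φ̂`. Hence `φ̂(w) = ∑ p ш S(q)` over all factorizations `wy = p y q`
(`coeff_symLin`). For `w = P x^m` the cut at the final `y` returns `w`, and every other cut falls
inside `P`. There `S(q x^m y) = (-1)^(m+1) (z_m G^m x)(G S(q))`, so what remains are the sums `∑ p ш
(d S_j(q))` over `P = p y q`, with `S_j = [t^j] G S` and `d = z_(m+l') x`
(`coeff_symLin_mul_x_pow`). The core is `cutSum_sh`: when `d = cu` ends in a letter `u`, this sum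
obeys a Leibniz rule in `P`, the factor not being cut getting shuffled into `c`. For `P = z_(k₁) ш ⋯
ш z_(kᵣ)` one factor `z_(kᵢ)` is cut at a time, at its only `y`. The result is `x S_j(x^(kᵢ-1)) = ±
binom(kᵢ+j-1, j) x^(kᵢ+j)`, which gives the `i`-th summand. -/

theorem word_concat (w : List Letter) (a : Letter) :
    word (w ++ [a]) = word w * FreeAlgebra.ι ℚ a := by
  simp [word]

theorem word_nil : word [] = 1 := rfl

theorem sh_comm (a b : H) : sh a b = sh b a := by
  have h : sh = sh.flip := by
    refine wordBasis.ext fun v => wordBasis.ext fun w => ?_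
    simp only [wordBasis_apply, LinearMap.flip_apply]
    induction v using List.reverseRecOn generalizing w with
    | nil => rw [word_nil, one_sh, sh_one]
    | append_singleton v p ihv =>
      induction w using List.reverseRecOn with
      | nil => rw [word_nil, one_sh, sh_one]
      | append_singleton w q ihw =>
        have e := ihv (w ++ [q])
        simp only [word_concat] at *
        rw [mul_letter_sh_mul_letter, mul_letter_sh_mul_letter, e, ihw, add_comm]
  exact LinearMap.congr_fun (LinearMap.congr_fun h a) b

/-- Sorted by last letter, each side has three pieces, and each piece is associativity with one of
the words shortened by a letter. -/
theorem sh_assoc (a b c : H) : sh (sh a b) c = sh a (sh b c) := by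
  have hw : ∀ u v w, sh (sh (word u) (word v)) (word w) = sh (word u) (sh (word v) (word w)) := by
    intro u
    induction u using List.reverseRecOn with
    | nil => intro v w; rw [word_nil, one_sh, one_sh]
    | append_singleton u p ihu =>
      intro v
      induction v using List.reverseRecOn with
      | nil => intro w; rw [word_nil, one_sh, sh_one]
      | append_singleton v q ihv =>
        intro w
        induction w using List.reverseRecOn with
        | nil => rw [word_nil, sh_one, sh_one]
        | append_singleton w s ihw =>
          have e1 := ihu (v ++ [q]) (w ++ [s])
          have e2 := ihv (w ++ [s])
          simp only [word_concat] at *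
          simp only [mul_letter_sh_mul_letter, map_add, LinearMap.add_apply] at *
          rw [e1, e2]
          simp only [← add_assoc] at *
          -- In the piece ending in `s` the product of the two other words has been expanded, so its
          -- hypothesis enters as a linear relation and not as a rewrite.
          have e3 := congrArg (· * FreeAlgebra.ι ℚ s) ihw
          simp only [add_mul] at e3 ⊢
          rw [← sub_eq_zero] at e3 ⊢
          rw [← e3]
          abel
  refine induction_word a (fun u => ?_) ?_ (fun p q hp hq => ?_) (fun r p hp => ?_)
  · refine induction_word b (fun v => ?_) ?_ (fun p q hp hq => ?_) (fun r p hp => ?_)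
    · refine induction_word c (fun w => hw u v w) ?_ (fun p q hp hq => ?_) (fun r p hp => ?_)
      · simp
      · simp only [map_add, hp, hq]
      · simp only [map_smul, hp]
    · simp
    · simp only [map_add, LinearMap.add_apply, hp, hq]
    · simp only [map_smul, LinearMap.smul_apply, hp]
  · simp
  · simp only [map_add, LinearMap.add_apply, hp, hq]
  · simp only [map_smul, LinearMap.smul_apply, hp]

theorem sh_left_comm (a b c : H) : sh a (sh b c) = sh b (sh a c) := by
  rw [← sh_assoc, sh_comm a b, sh_assoc]

noncomputable section

/-! ### Cutting words at the letter `y` -/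

/-- The sum of all `p ⊗ q` with `p y q` equal to the given word, which is read backwards. -/
def cutRev : List Letter → H ⊗[ℚ] H
  | [] => 0
  | Letter.x :: w => cutRev w * (1 ⊗ₜ x)
  | Letter.y :: w => word w.reverse ⊗ₜ 1 + cutRev w * (1 ⊗ₜ y)

/-- The linear map which sends a word `w` to the sum of all `p ⊗ q` with `p y q = w`. -/
def cut : H →ₗ[ℚ] H ⊗[ℚ] H :=
  wordBasis.constr ℚ fun w => cutRev w.reverse

theorem cut_word (w : List Letter) : cut (word w) = cutRev w.reverse := by
  rw [← wordBasis_apply, cut, Module.Basis.constr_basis]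

theorem cut_one : cut 1 = 0 := by
  rw [← word_nil, cut_word]; rfl

theorem cut_mul_x (a : H) : cut (a * x) = cut a * (1 ⊗ₜ x) := by
  refine induction_word a (fun w => ?_) ?_ (fun p q hp hq => ?_) (fun c p hp => ?_)
  · rw [x, ← word_concat, cut_word, cut_word, List.reverse_append]; rfl
  · simp
  · rw [add_mul, map_add, hp, hq, map_add, add_mul]
  · rw [smul_mul_assoc, map_smul, hp, map_smul, smul_mul_assoc]

theorem cut_mul_y (a : H) : cut (a * y) = a ⊗ₜ 1 + cut a * (1 ⊗ₜ y) := by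
  refine induction_word a (fun w => ?_) ?_ (fun p q hp hq => ?_) (fun c p hp => ?_)
  · rw [y, ← word_concat, cut_word, cut_word, List.reverse_append, List.reverse_singleton,
      List.singleton_append, cutRev, List.reverse_reverse]; rfl
  · simp
  · rw [add_mul, map_add, hp, hq, map_add, add_mul, TensorProduct.add_tmul]; abel
  · rw [smul_mul_assoc, map_smul, hp, map_smul, smul_mul_assoc, smul_add,
      TensorProduct.smul_tmul']

theorem cut_mul_x_pow (a : H) (n : ℕ) : cut (a * x ^ n) = cut a * (1 ⊗ₜ (x ^ n)) := by
  induction n with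
  | zero => rw [pow_zero, mul_one, ← Algebra.TensorProduct.one_def, mul_one]
  | succ n ih =>
    rw [pow_succ, ← mul_assoc, cut_mul_x, ih, mul_assoc, Algebra.TensorProduct.tmul_mul_tmul,
      one_mul]

theorem cut_y : cut y = 1 ⊗ₜ 1 := by
  have := cut_mul_y 1
  rwa [one_mul, cut_one, zero_mul, add_zero] at this

theorem cut_z (k : ℕ) : cut (z k) = 1 ⊗ₜ (x ^ (k - 1)) := by
  rw [z, cut_mul_x_pow, cut_y]
  simp

/-- The linear map `p ⊗ q ↦ p ш f(q)`. -/
def shTensor (f : H →ₗ[ℚ] H) : H ⊗[ℚ] H →ₗ[ℚ] H := TensorProduct.lift (sh.compl₂ f)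

theorem shTensor_tmul (f : H →ₗ[ℚ] H) (p q : H) : shTensor f (p ⊗ₜ q) = sh p (f q) := rfl

theorem shTensor_mul (f g : H →ₗ[ℚ] H) (b : H) (h : ∀ q, f (q * b) = g q) (T : H ⊗[ℚ] H) :
    shTensor f (T * (1 ⊗ₜ b)) = shTensor g T := by
  induction T using TensorProduct.induction_on with
  | zero => simp
  | tmul p q => rw [Algebra.TensorProduct.tmul_mul_tmul, mul_one, shTensor_tmul, h, shTensor_tmul]
  | add S T hS hT => rw [add_mul, map_add, hS, hT, map_add]

theorem shTensor_add (f g : H →ₗ[ℚ] H) (T : H ⊗[ℚ] H) :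
    shTensor (f + g) T = shTensor f T + shTensor g T := by
  induction T using TensorProduct.induction_on with
  | zero => simp
  | tmul p q => simp [shTensor_tmul]
  | add S T hS hT => rw [map_add, hS, hT, map_add, map_add]; abel

theorem shTensor_smul (c : ℚ) (f : H →ₗ[ℚ] H) (T : H ⊗[ℚ] H) :
    shTensor (c • f) T = c • shTensor f T := by
  induction T using TensorProduct.induction_on with
  | zero => simp
  | tmul p q => simp [shTensor_tmul]
  | add S T hS hT => rw [map_add, hS, hT, map_add, smul_add]

/-! ### The twisted antipode -/

/-- The geometric series `(1 - x t)⁻¹`. -/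
def geom : H⟦X⟧ := PowerSeries.mk fun n => x ^ n

theorem geom_eq : geom = 1 + PowerSeries.C x * (PowerSeries.X * geom) := by
  ext n : 1
  cases n with
  | zero => simp [geom]
  | succ n => simp [geom, PowerSeries.coeff_C_mul, PowerSeries.coeff_succ_X_mul,
      PowerSeries.coeff_one, pow_succ']

/-- On coefficients, `G^(d+2) = G^(d+1) + xt G^(d+2)` is Pascal's rule. -/
theorem coeff_geom_pow_succ (d n : ℕ) :
    PowerSeries.coeff n (geom ^ (d + 1)) = ((d + n).choose n : ℚ) • x ^ n := by
  induction d generalizing n with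
  | zero => simp [geom]
  | succ d ihd =>
    have h : geom ^ (d + 1 + 1)
        = geom ^ (d + 1) + PowerSeries.C x * (PowerSeries.X * geom ^ (d + 1 + 1)) := by
      calc geom ^ (d + 1 + 1)
          = (1 + PowerSeries.C x * (PowerSeries.X * geom)) * geom ^ (d + 1) := by
            rw [← geom_eq, ← pow_succ']
        _ = _ := by rw [add_mul, one_mul, mul_assoc, mul_assoc, ← pow_succ']
    induction n with
    | zero =>
      have := congrArg (PowerSeries.coeff 0) h
      rw [map_add, ihd, PowerSeries.coeff_C_mul, PowerSeries.coeff_zero_X_mul] at this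
      simpa using this
    | succ n ihn =>
      have := congrArg (PowerSeries.coeff (n + 1)) h
      rw [map_add, PowerSeries.coeff_C_mul, PowerSeries.coeff_succ_X_mul, ihn, ihd] at this
      rw [this, mul_smul_comm, ← pow_succ', ← add_smul]
      congr 1
      have e := Nat.choose_succ_succ (d + 1 + n) n
      rw [show d + 1 + (n + 1) = (d + 1 + n).succ by omega, e,
        show d + (n + 1) = d + 1 + n by omega]
      push_cast
      ring

theorem coeff_geom_pow {k : ℕ} (hk : 1 ≤ k) (n : ℕ) :
    PowerSeries.coeff n (geom ^ k) = ((k + n - 1).choose n : ℚ) • x ^ n := by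
  obtain ⟨d, rfl⟩ : ∃ d, k = d + 1 := ⟨k - 1, by omega⟩
  rw [coeff_geom_pow_succ, show d + 1 + n - 1 = d + n by omega]

theorem commute_geom_C_x : Commute geom (PowerSeries.C x) := by
  ext n : 1
  rw [PowerSeries.coeff_mul_C, PowerSeries.coeff_C_mul, geom, PowerSeries.coeff_mk,
    ← pow_succ, ← pow_succ']

/-- The algebra antihomomorphism with `x ↦ -x(1 - xt)⁻¹` and `y ↦ -y(1 - xt)⁻¹`. -/
def antipode : H →ₗ[ℚ] H⟦X⟧ :=
  (MulOpposite.opLinearEquiv ℚ).symm.toLinearMap ∘ₗ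
    (FreeAlgebra.lift ℚ fun u : Letter =>
      MulOpposite.op (-(PowerSeries.C (FreeAlgebra.ι ℚ u) * geom))).toLinearMap

theorem antipode_one : antipode 1 = 1 := by simp [antipode]

theorem antipode_mul (a b : H) : antipode (a * b) = antipode b * antipode a := by
  simp [antipode]

theorem antipode_ι (u : Letter) :
    antipode (FreeAlgebra.ι ℚ u) = -(PowerSeries.C (FreeAlgebra.ι ℚ u) * geom) := by
  simp [antipode]

theorem antipode_x_pow (n : ℕ) :
    antipode (x ^ n) = (-1 : ℚ) ^ n • (PowerSeries.C (x ^ n) * geom ^ n) := by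
  induction n with
  | zero => simp [antipode_one]
  | succ n ih =>
    have h : antipode x = -(PowerSeries.C x * geom) := antipode_ι _
    rw [pow_succ x, antipode_mul, ih, h, pow_succ (-1 : ℚ), pow_succ' geom, ← pow_succ x,
      pow_succ' x, map_mul, mul_smul_comm, mul_neg_one, neg_smul, neg_mul, smul_neg, mul_assoc,
      mul_assoc, ← mul_assoc geom, ← mul_assoc _ geom, map_pow,
      (commute_geom_C_x.pow_right n).eq]

/-- `S` reverses the factors and `x` commutes with `G`, so the `k` factors `G` collect on the right.
This is the contribution of one block to `φ̂`. -/
theorem antipode_x_pow_mul_y {k : ℕ} (hk : 1 ≤ k) :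
    antipode (x ^ (k - 1) * y) = (-1 : ℚ) ^ k • (PowerSeries.C (z k) * geom ^ k) := by
  obtain ⟨d, rfl⟩ : ∃ d, k = d + 1 := ⟨k - 1, by omega⟩
  rw [antipode_mul, antipode_x_pow, y, antipode_ι, ← y, z, Nat.add_sub_cancel, map_mul, map_pow,
    pow_succ (-1 : ℚ), mul_neg_one, neg_smul, mul_smul_comm, neg_mul, smul_neg, mul_assoc,
    mul_assoc, ← mul_assoc geom, (commute_geom_C_x.pow_right d).eq, mul_assoc, pow_succ']

/-- The coefficient of `tʲ` in `(1 - xt)⁻¹ S(q)`, where `S` is `antipode`. -/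
def geomAntipode (j : ℕ) : H →ₗ[ℚ] H :=
  (PowerSeries.coeff j).restrictScalars ℚ ∘ₗ LinearMap.mulLeft ℚ geom ∘ₗ antipode

theorem geomAntipode_apply (j : ℕ) (q : H) :
    geomAntipode j q = PowerSeries.coeff j (geom * antipode q) := rfl

theorem geomAntipode_zero_one : geomAntipode 0 1 = 1 := by
  simp [geomAntipode_apply, antipode_one, geom]

theorem geomAntipode_succ_one (j : ℕ) : geomAntipode (j + 1) 1 = x * geomAntipode j 1 := by
  simp [geomAntipode_apply, antipode_one, geom, pow_succ']

/-- Insert `G = 1 + xtG` in front of `S(qv) = -v G S(q)`. The extra factor `G` is what makes the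
recursion for `S_j` close up with only two terms. -/
theorem geom_mul_antipode_mul_ι (q : H) (v : Letter) :
    geom * antipode (q * FreeAlgebra.ι ℚ v)
      = -(PowerSeries.C (FreeAlgebra.ι ℚ v) * (geom * antipode q))
        + PowerSeries.C x * (PowerSeries.X * (geom * antipode (q * FreeAlgebra.ι ℚ v))) := by
  conv_lhs => rw [geom_eq]
  rw [add_mul, one_mul]
  congr 1
  · rw [antipode_mul, antipode_ι, neg_mul, mul_assoc]
  · simp only [mul_assoc]

theorem geomAntipode_zero_mul (q : H) (v : Letter) :
    geomAntipode 0 (q * FreeAlgebra.ι ℚ v) = -(FreeAlgebra.ι ℚ v * geomAntipode 0 q) := by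
  rw [geomAntipode_apply, geom_mul_antipode_mul_ι, map_add, map_neg, PowerSeries.coeff_C_mul,
    PowerSeries.coeff_C_mul, PowerSeries.coeff_zero_X_mul, mul_zero, add_zero, geomAntipode_apply]

theorem geomAntipode_succ_mul (j : ℕ) (q : H) (v : Letter) :
    geomAntipode (j + 1) (q * FreeAlgebra.ι ℚ v)
      = -(FreeAlgebra.ι ℚ v * geomAntipode (j + 1) q)
        + x * geomAntipode j (q * FreeAlgebra.ι ℚ v) := by
  rw [geomAntipode_apply, geom_mul_antipode_mul_ι, map_add, map_neg, PowerSeries.coeff_C_mul,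
    PowerSeries.coeff_C_mul, PowerSeries.coeff_succ_X_mul, geomAntipode_apply, geomAntipode_apply]

/-! ### Cuts of shuffle products -/

/-- The sum of all `p ш (d S_j(q))` over the decompositions `w = p y q`, where `S_j` is
`geomAntipode j`. -/
def cutSum (j : ℕ) (d w : H) : H :=
  shTensor (LinearMap.mulLeft ℚ d ∘ₗ geomAntipode j) (cut w)

theorem cutSum_add (j : ℕ) (d w w' : H) :
    cutSum j d (w + w') = cutSum j d w + cutSum j d w' := by
  simp [cutSum]

theorem cutSum_add_left (j : ℕ) (d d' w : H) :
    cutSum j (d + d') w = cutSum j d w + cutSum j d' w := by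
  rw [cutSum, cutSum, cutSum, ← shTensor_add]
  congr 2
  ext q
  simp [add_mul]

theorem cutSum_sub_left (j : ℕ) (d d' w : H) :
    cutSum j (d - d') w = cutSum j d w - cutSum j d' w := by
  rw [eq_sub_iff_add_eq, ← cutSum_add_left, sub_add_cancel]

theorem cutSum_zero_left (j : ℕ) (w : H) : cutSum j 0 w = 0 := by
  simpa using cutSum_sub_left j 0 0 w

theorem cutSum_smul_left (j : ℕ) (d w : H) (c : ℚ) : cutSum j (c • d) w = c • cutSum j d w := by
  rw [cutSum, cutSum, ← shTensor_smul]
  congr 2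
  ext q
  simp

theorem cutSum_zero (j : ℕ) (d : H) : cutSum j d 0 = 0 := by
  simp [cutSum]

theorem cutSum_smul (j : ℕ) (d w : H) (c : ℚ) : cutSum j d (c • w) = c • cutSum j d w := by
  simp [cutSum]

theorem cutSum_one (j : ℕ) (d : H) : cutSum j d 1 = 0 := by
  simp [cutSum, cut_one]

theorem cutSum_z (j : ℕ) (d : H) (k : ℕ) :
    cutSum j d (z k) = d * geomAntipode j (x ^ (k - 1)) := by
  rw [cutSum, cut_z]
  exact one_sh _

/-- The part of `cut (w * v)` in which the letter `v` itself is cut out. -/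
def lastCut : Letter → H →ₗ[ℚ] H
  | Letter.x => 0
  | Letter.y => LinearMap.id

theorem cut_mul_ι (a : H) (v : Letter) :
    cut (a * FreeAlgebra.ι ℚ v)
      = lastCut v a ⊗ₜ 1 + cut a * (1 ⊗ₜ FreeAlgebra.ι ℚ v) := by
  cases v with
  | x =>
    rw [lastCut, LinearMap.zero_apply, TensorProduct.zero_tmul, zero_add]
    exact cut_mul_x a
  | y => exact cut_mul_y a

theorem sh_lastCut (v : Letter) (a b : H) : sh (lastCut v a) b = lastCut v (sh a b) := by
  cases v <;> simp [lastCut]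

/-- The last letter `v` is either the cut itself, which requires `v = y`, or the last letter of `q`.
In the second case `S_0` moves it to the front with a minus sign, where `d` absorbs it. -/
theorem cutSum_zero_mul (d w : H) (v : Letter) :
    cutSum 0 d (w * FreeAlgebra.ι ℚ v)
      = lastCut v (sh w d) - cutSum 0 (d * FreeAlgebra.ι ℚ v) w := by
  rw [cutSum, cut_mul_ι, map_add, shTensor_tmul, sub_eq_add_neg]
  congr 1
  · simp [geomAntipode_zero_one, sh_lastCut]
  · rw [shTensor_mul _ (-(LinearMap.mulLeft ℚ (d * FreeAlgebra.ι ℚ v) ∘ₗ geomAntipode 0)),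
      ← neg_one_smul ℚ, shTensor_smul, neg_one_smul, cutSum]
    intro q
    simp [geomAntipode_zero_mul]

/-- As in degree zero, plus the term of the recursion that lowers `j` and appends `x` to `d`. The
cut at `v` itself is contained in that term, because `S_(j+1)(1) = x S_j(1)`. -/
theorem cutSum_succ_mul (j : ℕ) (d w : H) (v : Letter) :
    cutSum (j + 1) d (w * FreeAlgebra.ι ℚ v)
      = cutSum j (d * x) (w * FreeAlgebra.ι ℚ v)
        - cutSum (j + 1) (d * FreeAlgebra.ι ℚ v) w := by
  rw [cutSum, cutSum, cut_mul_ι, map_add, map_add, shTensor_tmul, shTensor_tmul, sub_eq_add_neg,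
    add_assoc]
  congr 1
  · simp [geomAntipode_succ_one]
  · rw [shTensor_mul _ (LinearMap.mulLeft ℚ (d * x) ∘ₗ geomAntipode j
        ∘ₗ LinearMap.mulRight ℚ (FreeAlgebra.ι ℚ v)
        + (-1 : ℚ) • (LinearMap.mulLeft ℚ (d * FreeAlgebra.ι ℚ v) ∘ₗ geomAntipode (j + 1))),
      shTensor_add, shTensor_smul, neg_one_smul, cutSum]
    · congr 1
      exact (shTensor_mul _ _ _ (fun q => rfl) _).symm
    · intro q
      simp [geomAntipode_succ_mul, mul_add, add_comm]

/-- `cutSum` is a derivation for the shuffle product. -/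
theorem cutSum_sh (j : ℕ) (c a b : H) (u : Letter) :
    cutSum j (c * FreeAlgebra.ι ℚ u) (sh a b)
      = cutSum j (sh b c * FreeAlgebra.ι ℚ u) a + cutSum j (sh a c * FreeAlgebra.ι ℚ u) b := by
  have hw : ∀ v w c u, cutSum j (c * FreeAlgebra.ι ℚ u) (sh (word v) (word w))
      = cutSum j (sh (word w) c * FreeAlgebra.ι ℚ u) (word v)
        + cutSum j (sh (word v) c * FreeAlgebra.ι ℚ u) (word w) := by
    -- The shuffle recursion solved for the term ending in `u`: afterwards `c` occurs only through
    -- `cu`, which is what the recursions for `cutSum` produce.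
    have hc : ∀ (a c : H) (p u : Letter),
        sh (a * FreeAlgebra.ι ℚ p) c * FreeAlgebra.ι ℚ u
          = sh (a * FreeAlgebra.ι ℚ p) (c * FreeAlgebra.ι ℚ u)
            - sh a (c * FreeAlgebra.ι ℚ u) * FreeAlgebra.ι ℚ p := fun a c p u => by
      rw [mul_letter_sh_mul_letter, add_sub_cancel_left]
    induction j with
    | zero =>
      intro v
      induction v using List.reverseRecOn with
      | nil => intro w c u; rw [word_nil, one_sh, one_sh, cutSum_one, zero_add]
      | append_singleton v p ihv =>
        intro w
        induction w using List.reverseRecOn with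
        | nil => intro c u; rw [word_nil, sh_one, one_sh, cutSum_one, add_zero]
        | append_singleton w q ihw =>
          intro c u
          -- The stripped letter becomes the new last letter of `d`, with `cu` in the role of `c`;
          -- hence the need for arbitrary `c` and `u`.
          have e1 := ihv (w ++ [q]) (c * FreeAlgebra.ι ℚ u) p
          have e2 := ihw (c * FreeAlgebra.ι ℚ u) q
          simp only [word_concat] at *
          generalize word v = a at *
          generalize word w = b at *
          rw [mul_letter_sh_mul_letter a b, cutSum_add, cutSum_zero_mul, cutSum_zero_mul, e1, e2,
            hc b c q u, hc a c p u, cutSum_sub_left, cutSum_sub_left,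
            cutSum_zero_mul (sh (b * FreeAlgebra.ι ℚ q) (c * FreeAlgebra.ι ℚ u)),
            cutSum_zero_mul (sh (a * FreeAlgebra.ι ℚ p) (c * FreeAlgebra.ι ℚ u)),
            sh_assoc, sh_assoc, sh_left_comm _ b]
          abel
    | succ j ihj =>
      intro v
      induction v using List.reverseRecOn with
      | nil => intro w c u; rw [word_nil, one_sh, one_sh, cutSum_one, zero_add]
      | append_singleton v p ihv =>
        intro w
        induction w using List.reverseRecOn with
        | nil => intro c u; rw [word_nil, sh_one, one_sh, cutSum_one, add_zero]
        | append_singleton w q ihw =>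
          intro c u
          have e1 := ihv (w ++ [q]) (c * FreeAlgebra.ι ℚ u) p
          have e2 := ihw (c * FreeAlgebra.ι ℚ u) q
          -- The Leibniz rule in degree `j` for `cux` matches all terms in which `j` was lowered. It
          -- takes the place of the `lastCut` terms of degree zero.
          have e3 := ihj (v ++ [p]) (w ++ [q]) (c * FreeAlgebra.ι ℚ u) Letter.x
          simp only [word_concat] at *
          generalize word v = a at *
          generalize word w = b at *
          rw [mul_letter_sh_mul_letter a b, cutSum_add, ← x] at e3
          rw [mul_letter_sh_mul_letter a b, cutSum_add, cutSum_succ_mul, cutSum_succ_mul, e1, e2,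
            hc b c q u, hc a c p u, cutSum_sub_left, cutSum_sub_left,
            cutSum_succ_mul j (sh (b * FreeAlgebra.ι ℚ q) (c * FreeAlgebra.ι ℚ u)),
            cutSum_succ_mul j (sh (a * FreeAlgebra.ι ℚ p) (c * FreeAlgebra.ι ℚ u))]
          rw [← sub_eq_zero] at e3 ⊢
          rw [← e3]
          abel
  refine induction_word a (fun v => ?_) ?_ (fun p q hp hq => ?_) (fun r p hp => ?_)
  · refine induction_word b (fun w => hw v w c u) ?_ (fun p q hp hq => ?_) (fun r p hp => ?_)
    · simp [cutSum_zero, cutSum_zero_left]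
    · simp only [map_add, LinearMap.add_apply, add_mul, cutSum_add, cutSum_add_left, hp, hq]; abel
    · simp only [map_smul, LinearMap.smul_apply, smul_mul_assoc, cutSum_smul, cutSum_smul_left, hp,
        smul_add]
  · simp [cutSum_zero, cutSum_zero_left]
  · simp only [map_add, LinearMap.add_apply, add_mul, cutSum_add, cutSum_add_left, hp, hq]; abel
  · simp only [map_smul, LinearMap.smul_apply, smul_mul_assoc, cutSum_smul, cutSum_smul_left, hp,
      smul_add]

/-! ### Cuts of iterated shuffle products -/

theorem shProd_concat (L : List H) (a : H) : shProd (L ++ [a]) = sh (shProd L) a := by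
  simp [shProd]

/-- The Leibniz rule iterated: the uncut factors accumulate in `c`. Since `i` stays below the
length, the default `0` is never read. -/
theorem cutSum_shProd (j : ℕ) (c : H) (u : Letter) (L : List H) :
    cutSum j (c * FreeAlgebra.ι ℚ u) (shProd L)
      = ∑ i ∈ Finset.range L.length,
          cutSum j (sh (shProd (L.eraseIdx i)) c * FreeAlgebra.ι ℚ u) (L.getD i 0) := by
  induction L using List.reverseRecOn generalizing c with
  | nil => exact cutSum_one _ _
  | append_singleton L a ih =>
    rw [shProd_concat, cutSum_sh, ih, List.length_append, List.length_singleton,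
      Finset.sum_range_succ]
    congr 1
    · refine Finset.sum_congr rfl fun i hi => ?_
      have hi := Finset.mem_range.1 hi
      rw [List.eraseIdx_append_of_lt_length hi, shProd_concat, sh_assoc,
        List.getD_append _ _ _ _ hi]
    · rw [List.eraseIdx_append_of_length_le le_rfl, List.getD_append_right _ _ _ _ le_rfl]
      simp

/-! ### The symmetrization map in terms of cuts -/

theorem zWord_concat (k : List ℕ) (m : ℕ) : zWord (k ++ [m]) = zWord k * z m := by
  simp [zWord]

/-- `x^{k₁-1} y ⋯ x^{kᵣ-1} y`. -/
def xyWord (k : List ℕ) : H := (k.map fun m => x ^ (m - 1) * y).prod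

/-- Each `z` begins with `y`, so a cut leaves complete `z`-blocks on the left; the appended `y`
completes the blocks `x^(k-1) y` on the right and supplies the cut `i = r`. -/
theorem cut_zWord_mul_y (k : List ℕ) :
    cut (zWord k * y)
      = ∑ i ∈ Finset.range (k.length + 1), zWord (k.take i) ⊗ₜ xyWord (k.drop i) := by
  induction k using List.reverseRecOn with
  | nil => simp [zWord, xyWord, cut_y]
  | append_singleton k m ih =>
    rw [cut_mul_y, zWord_concat, z, ← mul_assoc, cut_mul_x_pow, ih, List.length_append,
      List.length_singleton, Finset.sum_range_succ _ (k.length + 1), add_comm]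
    congr 1
    · rw [Finset.sum_mul, Finset.sum_mul]
      refine Finset.sum_congr rfl fun i hi => ?_
      have hi : i ≤ k.length := Nat.lt_succ_iff.1 (Finset.mem_range.1 hi)
      rw [List.take_append_of_le_length hi, List.drop_append_of_le_length hi]
      simp [xyWord, mul_assoc]
    · rw [List.take_of_length_le (by simp), List.drop_of_length_le (by simp), zWord_concat, z,
        ← mul_assoc]
      rfl

theorem sum_antidiagonalTuple_succ {M : Type*} [AddCommMonoid M] (r n : ℕ)
    (f : List ℕ → M) :
    ∑ l ∈ Finset.Nat.antidiagonalTuple (r + 1) n, f (List.ofFn l)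
      = ∑ p ∈ Finset.HasAntidiagonal.antidiagonal n,
          ∑ l ∈ Finset.Nat.antidiagonalTuple r p.2, f (p.1 :: List.ofFn l) := by
  rw [Finset.sum_sigma']
  refine Finset.sum_bij' (fun l _ => ⟨(l 0, ∑ i, Fin.tail l i), Fin.tail l⟩)
    (fun s _ => Fin.cons s.1.1 s.2) ?_ ?_ ?_ ?_ ?_
  · intro l hl
    simpa [Finset.Nat.mem_antidiagonalTuple, Fin.sum_univ_succ, Fin.tail] using hl
  · rintro ⟨⟨a, b⟩, l⟩ h
    simp only [Finset.mem_sigma, Finset.Nat.mem_antidiagonalTuple,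
      Finset.HasAntidiagonal.mem_antidiagonal] at h
    simp [Finset.Nat.mem_antidiagonalTuple, Fin.sum_univ_succ, h.2, h.1]
  · intro l _
    exact Fin.cons_self_tail l
  · rintro ⟨⟨a, b⟩, l⟩ h
    simp only [Finset.mem_sigma, Finset.Nat.mem_antidiagonalTuple] at h
    simp [h.2]
  · intro l _
    rw [List.ofFn_succ]
    rfl

/-- `S` reverses the order of the blocks and turns each into `± z_m G^m`; expanding the product of
the powers of `G` gives the sum over `l`. -/
theorem coeff_antipode_xyWord (k : List ℕ) (hk : ∀ m ∈ k, 1 ≤ m) (n : ℕ) :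
    PowerSeries.coeff n (antipode (xyWord k))
      = (-1 : ℚ) ^ k.sum • ∑ l ∈ Finset.Nat.antidiagonalTuple k.length n,
          (bBinom k (List.ofFn l) : ℚ) • zWord (List.zipWith (· + ·) k (List.ofFn l)).reverse := by
  induction k generalizing n with
  | nil =>
    cases n <;> simp [xyWord, antipode_one, bBinom, zWord, PowerSeries.coeff_one]
  | cons m k ih =>
    have hm : 1 ≤ m := hk m (by simp)
    rw [List.length_cons, sum_antidiagonalTuple_succ k.length n fun l =>
      (bBinom (m :: k) l : ℚ) • zWord (List.zipWith (· + ·) (m :: k) l).reverse]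
    -- The first block becomes the last factor, so the antidiagonal has to be swapped to match the
    -- first entry of `l`.
    rw [xyWord, List.map_cons, List.prod_cons, ← xyWord, antipode_mul, antipode_x_pow_mul_y hm,
      PowerSeries.coeff_mul, ← Finset.Nat.sum_antidiagonal_swap, Finset.smul_sum]
    refine Finset.sum_congr rfl fun p _ => ?_
    rw [Prod.fst_swap, Prod.snd_swap, ih fun m hm => hk m (by simp [hm])]
    rw [PowerSeries.coeff_smul, PowerSeries.coeff_C_mul, coeff_geom_pow hm, List.sum_cons]
    simp only [Finset.smul_sum, Finset.sum_mul]
    refine Finset.sum_congr rfl fun l _ => ?_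
    have hz : z m * x ^ p.1 = z (m + p.1) := by
      rw [z, z, mul_assoc, ← pow_add, show m - 1 + p.1 = m + p.1 - 1 by omega]
    rw [mul_smul_comm _ (z m), hz, List.zipWith_cons_cons, List.reverse_cons, zWord_concat, bBinom, bBinom,
      List.zipWith_cons_cons, List.prod_cons, pow_add]
    simp only [smul_mul_assoc, mul_smul_comm, smul_smul]
    push_cast
    ring_nf

theorem symCoeff_eq_cut (k : List ℕ) (hk : ∀ m ∈ k, 1 ≤ m) (n : ℕ) :
    symCoeff k n = shTensor ((PowerSeries.coeff n).restrictScalars ℚ ∘ₗ antipode)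
      (cut (zWord k * y)) := by
  rw [symCoeff, cut_zWord_mul_y, map_sum]
  refine Finset.sum_congr rfl fun i _ => ?_
  rw [shTensor_tmul, ← map_smul]
  congr 1
  rw [← List.length_drop, LinearMap.comp_apply, LinearMap.restrictScalars_apply,
    coeff_antipode_xyWord _ fun m hm => hk m (List.mem_of_mem_drop hm)]

/-- `φ̂(w)` is the sum of all `p ш S(q)` over the decompositions `w y = p y q`, where `S` is
`antipode`. -/
theorem coeff_symLin (w : H1) (n : ℕ) :
    ((PowerSeries.coeff n (symLin w) : H1) : H)
      = shTensor ((PowerSeries.coeff n).restrictScalars ℚ ∘ₗ antipode) (cut (w * y)) := by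
  have h : H1.val.toLinearMap ∘ₗ (PowerSeries.coeff n).restrictScalars ℚ ∘ₗ symLin
      = shTensor ((PowerSeries.coeff n).restrictScalars ℚ ∘ₗ antipode) ∘ₗ cut
        ∘ₗ LinearMap.mulRight ℚ y ∘ₗ H1.val.toLinearMap := by
    refine zBasis.ext fun k => ?_
    have := coeff_symHat_zElt k n
    rw [symHat_C] at this
    rw [zBasis_apply]
    refine this.trans (symCoeff_eq_cut _ (fun m hm => ?_) n)
    obtain ⟨m, -, rfl⟩ := List.mem_map.1 hm
    exact m.pos
  exact LinearMap.congr_fun h w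

/-! ### Symmetrization of elements ending in a power of `x` -/

theorem shTensor_sum {ι : Type*} (s : Finset ι) (f : ι → H →ₗ[ℚ] H) (T : H ⊗[ℚ] H) :
    shTensor (∑ i ∈ s, f i) T = ∑ i ∈ s, shTensor (f i) T :=
  map_sum (AddMonoidHom.mk' (fun f => shTensor f T) fun f g => shTensor_add f g T) f s

/-- Split `z_(m+1) G^(m+1)` as `(z_m G^m x) G`. The power `G^m` gives the binomial, the last `G`
joins `S(q)`, and the `x` in between is the final letter that `cutSum_sh` requires. -/
theorem coeff_antipode_mul (q : H) {m : ℕ} (hm : 1 ≤ m) (n : ℕ) :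
    PowerSeries.coeff n (antipode (q * (x ^ m * y)))
      = (-1 : ℚ) ^ (m + 1) • ∑ p ∈ Finset.HasAntidiagonal.antidiagonal n,
          ((m + p.2 - 1).choose p.2 : ℚ) • (z (m + p.2) * x * geomAntipode p.1 q) := by
  have h := antipode_x_pow_mul_y (Nat.le_add_left 1 m)
  rw [Nat.add_sub_cancel] at h
  have hz : ∀ l, z (m + l) = z m * x ^ l := fun l => by
    rw [z, z, mul_assoc, ← pow_add, show m - 1 + l = m + l - 1 by omega]
  have e : PowerSeries.C (z (m + 1)) * geom ^ (m + 1) * antipode q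
      = PowerSeries.C (z m) * geom ^ m * PowerSeries.C x * (geom * antipode q) := by
    rw [hz, pow_one, map_mul, mul_assoc (PowerSeries.C (z m)) (geom ^ m),
      (commute_geom_C_x.pow_left m).eq, pow_succ]
    simp only [mul_assoc]
  rw [antipode_mul, h, smul_mul_assoc, e, PowerSeries.coeff_smul, PowerSeries.coeff_mul,
    ← Finset.Nat.sum_antidiagonal_swap]
  congr 1
  refine Finset.sum_congr rfl fun p _ => ?_
  rw [Prod.fst_swap, Prod.snd_swap, PowerSeries.coeff_mul_C, PowerSeries.coeff_C_mul,
    coeff_geom_pow hm, mul_smul_comm, ← hz, smul_mul_assoc, smul_mul_assoc, geomAntipode_apply]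

theorem coeff_symLin_mul_x_pow (w : H1) (P : H) {m : ℕ} (hm : 1 ≤ m) (hw : (w : H) = P * x ^ m)
    (n : ℕ) :
    ((PowerSeries.coeff n (symLin w) : H1) : H)
      = (if n = 0 then P * x ^ m else 0)
        + (-1 : ℚ) ^ (m + 1) • ∑ p ∈ Finset.HasAntidiagonal.antidiagonal n,
          ((m + p.2 - 1).choose p.2 : ℚ) • cutSum p.1 (z (m + p.2) * x) P := by
  have e : (1 : H) ⊗ₜ[ℚ] (x ^ m) * (1 : H) ⊗ₜ[ℚ] y = 1 ⊗ₜ (x ^ m * y) := by simp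
  rw [coeff_symLin, hw, cut_mul_y, cut_mul_x_pow, mul_assoc (cut P), e, map_add, shTensor_tmul]
  congr 1
  · rw [LinearMap.comp_apply, LinearMap.restrictScalars_apply, antipode_one,
      PowerSeries.coeff_one]
    split_ifs
    · rw [sh_one]
    · rw [map_zero]
  · rw [shTensor_mul _ ((-1 : ℚ) ^ (m + 1) • ∑ p ∈ Finset.HasAntidiagonal.antidiagonal n,
        ((m + p.2 - 1).choose p.2 : ℚ) •
          (LinearMap.mulLeft ℚ (z (m + p.2) * x) ∘ₗ geomAntipode p.1)),
      shTensor_smul, shTensor_sum]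
    · simp only [shTensor_smul, cutSum]
    · intro q
      rw [LinearMap.comp_apply, LinearMap.restrictScalars_apply, coeff_antipode_mul q hm]
      simp [LinearMap.sum_apply, mul_assoc]

/-- Up to sign, `x G S(x^(k-1))` is `x^k G^k`. -/
theorem x_mul_geomAntipode_x_pow {k : ℕ} (hk : 1 ≤ k) (j : ℕ) :
    x * geomAntipode j (x ^ (k - 1))
      = (-1 : ℚ) ^ (k - 1) • ((k + j - 1).choose j : ℚ) • x ^ (k + j) := by
  obtain ⟨d, rfl⟩ : ∃ d, k = d + 1 := ⟨k - 1, by omega⟩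
  rw [geomAntipode_apply, Nat.add_sub_cancel, antipode_x_pow, mul_smul_comm, ← mul_assoc, map_pow,
    (commute_geom_C_x.pow_right d).eq, mul_assoc, ← pow_succ', PowerSeries.coeff_smul, ← map_pow,
    PowerSeries.coeff_C_mul, coeff_geom_pow hk, mul_smul_comm, mul_smul_comm, mul_smul_comm,
    ← pow_add, ← pow_succ', show d + j + 1 = d + 1 + j by omega]

end

end TAdicSym

/-- The formula is stated in `𝔥⟦t⟧ ⊇ 𝔥¹⟦t⟧`; the double sum over `l, l' ≥ 0` is written as the
power series whose coefficient of `tⁿ` is the sum over all `(l, l')` with `l + l' = n`. -/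
theorem corollary3p9 (r : ℕ) (hr : 1 ≤ r) (k : Fin (r + 1) → ℕ+) :
    PowerSeries.map TAdicSym.H1.val.toRingHom
        (TAdicSym.symHat (PowerSeries.C
          ⟨TAdicSym.shProd (List.ofFn fun i : Fin r => TAdicSym.z (k i.castSucc))
              * TAdicSym.x ^ (k (Fin.last r) : ℕ),
            TAdicSym.shProd_mul_pow_mem_H1 hr _ _⟩)) =
      PowerSeries.C
          (TAdicSym.shProd (List.ofFn fun i : Fin r => TAdicSym.z (k i.castSucc))
            * TAdicSym.x ^ (k (Fin.last r) : ℕ))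
        + ∑ i : Fin r, (-1 : ℚ) ^ ((k i.castSucc : ℕ) + k (Fin.last r)) •
            PowerSeries.mk fun n => ∑ p ∈ Finset.HasAntidiagonal.antidiagonal n,
              ((((k i.castSucc : ℕ) + p.1 - 1).choose p.1 : ℚ)
                  * (((k (Fin.last r) : ℕ) + p.2 - 1).choose p.2 : ℚ)) •
                (TAdicSym.shProd
                    (((List.ofFn fun j : Fin r => TAdicSym.z (k j.castSucc)).eraseIdx i)
                      ++ [TAdicSym.z ((k (Fin.last r) : ℕ) + p.2)])
                  * TAdicSym.x ^ ((k i.castSucc : ℕ) + p.1)) := by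
  -- The Leibniz rule with last letter `x`; below, `c` will be `z_(m+l')` with `m` the last index.
  have hcut : ∀ (j : ℕ) (c : TAdicSym.H),
      TAdicSym.cutSum j (c * TAdicSym.x)
          (TAdicSym.shProd (List.ofFn fun i : Fin r => TAdicSym.z (k i.castSucc)))
        = ∑ i : Fin r, (-1 : ℚ) ^ ((k i.castSucc : ℕ) - 1) •
          (((k i.castSucc : ℕ) + j - 1).choose j : ℚ) •
            (TAdicSym.shProd (((List.ofFn fun i : Fin r => TAdicSym.z (k i.castSucc)).eraseIdx i)
              ++ [c]) * TAdicSym.x ^ ((k i.castSucc : ℕ) + j)) := fun j c => by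
    rw [TAdicSym.x, TAdicSym.cutSum_shProd, List.length_ofFn, Finset.sum_range]
    refine Finset.sum_congr rfl fun i _ => ?_
    have hi : (List.ofFn fun i : Fin r => TAdicSym.z (k i.castSucc)).getD i 0
        = TAdicSym.z (k i.castSucc) := by
      simp
    rw [hi, TAdicSym.cutSum_z, ← TAdicSym.x, mul_assoc,
      TAdicSym.x_mul_geomAntipode_x_pow (k i.castSucc).pos, mul_smul_comm, mul_smul_comm,
      TAdicSym.shProd_concat]
  ext n : 1
  rw [TAdicSym.symHat_C, PowerSeries.coeff_map, map_add, PowerSeries.coeff_C]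
  refine (TAdicSym.coeff_symLin_mul_x_pow _ _ (k (Fin.last r)).pos rfl n).trans ?_
  congr 1
  rw [map_sum]
  simp only [PowerSeries.coeff_smul, PowerSeries.coeff_mk, hcut, Finset.smul_sum]
  rw [Finset.sum_comm]
  refine Finset.sum_congr rfl fun i _ => Finset.sum_congr rfl fun p _ => ?_
  simp only [smul_smul]
  congr 1
  -- The signs combine as `(-1)^(m+1) (-1)^(kᵢ-1) = (-1)^(kᵢ+m)`; writing `kᵢ = d + 1` removes the
  -- truncated subtraction.
  obtain ⟨d, hd⟩ : ∃ d, (k i.castSucc : ℕ) = d + 1 :=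
    ⟨_, (Nat.succ_pred_eq_of_pos (k i.castSucc).pos).symm⟩
  rw [hd, Nat.add_sub_cancel]
  ring
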